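/- **Conventions.** All languages are algebraic (finitary operation symbols only). Algebras may be empty when their language has no constant symbols. An *equation* in variables $V$ is a pair of terms in variables $V$; a *generalized quasi-equation* is an implication $\bigl(\bigwedge_{i\in I}\alpha_i\approx\beta_i\bigr)\to\varphi\approx\psi$ between equations, with $I$ a possibly infinite set. A *generalized quasi-variety* is a class of algebras of one language axiomatized by a set of generalized quasi-equations whose number of variables is bounded by some infinite cardinal; it is regarded as a category whose arrows are all homomorphisms. $\mathscr L_{\mathsf K}$ is the language of a class $\mathsf K$, and $\Phi\vDash_{\mathsf K}\epsilon\approx\delta$ means that every assignment into an algebra of $\mathsf K$ that satisfies all equations in $\Phi$ satisfies $\epsilon\approx\delta$. A right adjoint functor is *trivial* if it sends every object to a terminal object. *Matrix powers.* For a cardinal $\kappa>0$, $\mathscr L^{\kappa}_{\mathsf Y}$ is the language whose $n$-ary symbols are the $\kappa$-sequences $\langle t_i:i<\kappa\rangle$ of terms of $\mathscr L_{\mathsf Y}$ in the variables $x^j_m$ ($1\le m\le n$, $j<\kappa$). For $A\in\mathsf Y$, $A^{[\kappa]}$ is the $\mathscr L^{\kappa}_{\mathsf Y}$-algebra with universe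 $A^\kappa$ in which $\langle t_i\rangle(a_1,\dots,a_n)=\langle t_i^{A}(a_1/\vec x_1,\dots,a_n/\vec x_n):i<\kappa\rangle$; $\mathsf Y^{[\kappa]}$ is the class of isomorphic copies of the algebras $A^{[\kappa]}$, $A\in\mathsf Y$. If $\mathsf Y^{[\kappa]}\subseteq\mathsf K$, the functor $[\kappa]:\mathsf Y\to\mathsf K$ sends $A$ to $A^{[\kappa]}$ and a homomorphism $f$ to $f$ applied componentwise. *Solution sets.* Let $\mathsf K$ be a class of similar algebras, $\mathscr L\subseteq\mathscr L_{\mathsf K}$ a set of operation symbols, and $\theta$ a set of equations of $\mathscr L_{\mathsf K}$ in one variable. $\theta$ is *compatible with $\mathscr L$ in $\mathsf K$* if $\theta(x_1)\cup\dots\cup\theta(x_n)\vDash_{\mathsf K}\theta(\varphi(x_1,\dots,x_n))$ for every $n$-ary $\varphi\in\mathscr L$. Then $\theta_{\mathscr L}(A)$, for $A\in\mathsf K$, is the set of solutions of $\theta$ in $A$ with the restrictions of the operations in $\mathscr L$, and $\theta_{\mathscr L}(f)$ is the restriction of the homomorphism $f$. In speaking of a functor $\theta_{\mathscr L}:\mathsf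 K\to\mathsf X$ we mean that an arity-preserving map from $\mathscr L_{\mathsf X}$ onto $\mathscr L$ is given, along which the algebras $\theta_{\mathscr L}(A)$ are read as algebras of type $\mathscr L_{\mathsf X}$, and that all of them then belong to $\mathsf X$. **Theorem.** Let $\mathsf X$ and $\mathsf Y$ be generalized quasi-varieties. 1. For every non-trivial right adjoint $\mathcal G:\mathsf Y\to\mathsf X$ there are a cardinal $\kappa>0$, a generalized quasi-variety $\mathsf K\supseteq\mathsf Y^{[\kappa]}$ of type $\mathscr L^{\kappa}_{\mathsf Y}$, a sublanguage $\mathscr L\subseteq\mathscr L^{\kappa}_{\mathsf Y}$, a set $\theta$ of equations of $\mathscr L^{\kappa}_{\mathsf Y}$ in one variable that is compatible with $\mathscr L$ in $\mathsf K$, and functors $[\kappa]:\mathsf Y\to\mathsf K$ and $\theta_{\mathscr L}:\mathsf K\to\mathsf X$ as above, such that $\mathcal G$ is naturally isomorphic to $\theta_{\mathscr L}\circ[\kappa]$. 2. Conversely, for every cardinal $\kappa>0$, every $\mathscr L\subseteq\mathscr L^{\kappa}_{\mathsf Y}$ and every set $\theta$ of equations of $\mathscr L^{\kappa}_{\mathsf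 Y}$ in one variable that is compatible with $\mathscr L$ in $\mathsf Y^{[\kappa]}$, every functor $\theta_{\mathscr L}\circ[\kappa]:\mathsf Y\to\mathsf X$, where $[\kappa]:\mathsf Y\to\mathsf Y^{[\kappa]}$ and $\theta_{\mathscr L}:\mathsf Y^{[\kappa]}\to\mathsf X$, is a right adjoint. -/

import Mathlib

open CategoryTheory
open scoped FirstOrder

universe u w

namespace UAlg

/-- An algebra of type `L`; the carrier may be empty (when `L` has no constant symbols). It is used
only for algebraic languages, i.e. languages without relation symbols. -/
structure Alg (L : FirstOrder.Language.{u, 0}) where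
  carrier : Type u
  str : L.Structure carrier

instance (L : FirstOrder.Language.{u, 0}) : CoeSort (Alg L) (Type u) := ⟨Alg.carrier⟩

instance (L : FirstOrder.Language.{u, 0}) (A : Alg L) : L.Structure A := A.str

/-- The category of all algebras of type `L` and homomorphisms. -/
instance (L : FirstOrder.Language.{u, 0}) : Category (Alg L) where
  Hom A B := A →[L] B
  id A := FirstOrder.Language.Hom.id L A
  comp f g := g.comp f

/-- A class of algebras of type `L`; it is regarded as the full subcategory
`K.FullSubcategory` of the category of all algebras. -/
abbrev AlgClass (L : FirstOrder.Language.{u, 0}) := ObjectProperty (Alg L)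

/-- Equations `s ≈ t` in variables `V` are pairs of terms. -/
abbrev Equation (L : FirstOrder.Language.{u, 0}) (V : Type w) := L.Term V × L.Term V

/-- The equation `e` is true in `A` under the assignment `v`. -/
def Equation.Holds {L : FirstOrder.Language.{u, 0}} {V : Type w} (e : Equation L V) (A : Alg L)
    (v : V → A) : Prop :=
  e.1.realize v = e.2.realize v

/-- The generalized quasi-equation `⋀ premises → conclusion` in variables `V`. -/
structure GenQuasiEquation (L : FirstOrder.Language.{u, 0}) (V : Type w) where
  premises : Set (Equation L V)
  conclusion : Equation L V

/-- Validity of a generalized quasi-equation in an algebra. -/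
def GenQuasiEquation.Valid {L : FirstOrder.Language.{u, 0}} {V : Type w} (q : GenQuasiEquation L V)
    (A : Alg L) : Prop :=
  ∀ v : V → A, (∀ e ∈ q.premises, Equation.Holds e A v) → Equation.Holds q.conclusion A v

/-- A generalized quasi-variety: a class axiomatized by a set of generalized quasi-equations
whose variables are taken from some fixed infinite set. -/
def IsGenQuasiVariety {L : FirstOrder.Language.{u, 0}} (K : AlgClass L) : Prop :=
  ∃ V : Type u, Infinite V ∧ ∃ Γ : Set (GenQuasiEquation L V), ∀ A : Alg L, K A ↔ ∀ q ∈ Γ, q.Valid A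

/-- The equational consequence `Φ ⊨_K e` relative to `K`. -/
def Consequence {L : FirstOrder.Language.{u, 0}} (K : AlgClass L) {V : Type w} (Φ : Set (Equation L V))
    (e : Equation L V) : Prop :=
  ∀ A : Alg L, K A → ∀ v : V → A, (∀ d ∈ Φ, Equation.Holds d A v) → Equation.Holds e A v

/-! ### Matrix powers -/

/-- The language `L^κ`: its `n`-ary operations are the `κ`-sequences of terms of `L` in the
variables `x^j_m` with `m : Fin n` and `j : κ`. -/
def matrixLanguage (L : FirstOrder.Language.{u, 0}) (κ : Type u) : FirstOrder.Language.{u, 0} where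
  Functions n := κ → L.Term (Fin n × κ)
  Relations _ := Empty

instance (L : FirstOrder.Language.{u, 0}) (κ : Type u) : (matrixLanguage L κ).IsAlgebraic :=
  fun _ => inferInstanceAs (IsEmpty Empty)

/-- The matrix power `A^[κ]`. -/
def matrixPower {L : FirstOrder.Language.{u, 0}} (κ : Type u) (A : Alg L) : Alg (matrixLanguage L κ) where
  carrier := κ → A
  str :=
    { funMap := fun t a i => FirstOrder.Language.Term.realize (fun p => a p.1 p.2) (t i)
      RelMap := fun r _ => isEmptyElim r }

/-- The homomorphism `f^[κ]`, that is, `f` applied componentwise. -/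
def matrixPowerMap {L : FirstOrder.Language.{u, 0}} (κ : Type u) {A B : Alg L} (f : A →[L] B) :
    matrixPower κ A →[matrixLanguage L κ] matrixPower κ B where
  toFun a := fun i => f (a i)
  map_fun' t a := by
    funext i
    exact (FirstOrder.Language.HomClass.realize_term f (t := t i) (v := fun p => a p.1 p.2)).symm
  map_rel' r _ := isEmptyElim r

/-- The class `Y^[κ]` of all isomorphic copies of matrix powers `A^[κ]` with `A ∈ Y`. -/
def matrixPowerClass {L : FirstOrder.Language.{u, 0}} (κ : Type u) (Y : AlgClass L) :
    AlgClass (matrixLanguage L κ) :=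
  fun B => ∃ A : Alg L, Y A ∧ Nonempty (matrixPower κ A ≅ B)

theorem matrixPower_mem {L : FirstOrder.Language.{u, 0}} (κ : Type u) (Y : AlgClass L) (A : Alg L)
    (hA : Y A) : matrixPowerClass κ Y (matrixPower κ A) :=
  ⟨A, hA, ⟨Iso.refl _⟩⟩

/-- The functor `[κ] : Y ⥤ K`, defined whenever `Y^[κ] ⊆ K`. -/
def matrixPowerFunctor {L : FirstOrder.Language.{u, 0}} (κ : Type u) (Y : AlgClass L)
    (K : AlgClass (matrixLanguage L κ)) (h : matrixPowerClass κ Y ≤ K) :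
    Y.FullSubcategory ⥤ K.FullSubcategory where
  obj A := ⟨matrixPower κ A.obj, h _ (matrixPower_mem κ Y A.obj A.property)⟩
  map f := ObjectProperty.homMk (matrixPowerMap κ f.hom)

/-! ### Solution sets of compatible equations -/

/-- A sublanguage `S ⊆ L`: a set of operation symbols of `L`. -/
abbrev Sublanguage (L : FirstOrder.Language.{u, 0}) := ∀ n : ℕ, Set (L.Functions n)

/-- A sublanguage as a language in its own right. -/
def Sublanguage.toLanguage {L : FirstOrder.Language.{u, 0}} (S : Sublanguage L) : FirstOrder.Language.{u, 0} where
  Functions n := S n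
  Relations _ := Empty

instance {L : FirstOrder.Language.{u, 0}} (S : Sublanguage L) : S.toLanguage.IsAlgebraic :=
  fun _ => inferInstanceAs (IsEmpty Empty)

/-- For a set `θ = θ(x)` of equations in one variable and a term `t`, the set `θ(t)`. -/
def substEqs {L : FirstOrder.Language.{u, 0}} (θ : Set (Equation L (Fin 1))) {V : Type w} (t : L.Term V) :
    Set (Equation L V) :=
  (fun e => (e.1.subst fun _ => t, e.2.subst fun _ => t)) '' θ

/-- `θ` is compatible with `S` in `K`: for every `n`-ary symbol `φ ∈ S`,
`θ(x₁) ∪ ⋯ ∪ θ(xₙ) ⊨_K θ(φ(x₁, …, xₙ))`. -/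
def Compatible {L : FirstOrder.Language.{u, 0}} (K : AlgClass L) (θ : Set (Equation L (Fin 1)))
    (S : Sublanguage L) : Prop :=
  ∀ (n : ℕ) (φ : L.Functions n), φ ∈ S n →
    ∀ e ∈ substEqs θ (FirstOrder.Language.Term.func φ fun i : Fin n => FirstOrder.Language.Term.var i),
      Consequence K (⋃ i : Fin n, substEqs θ (FirstOrder.Language.Term.var i : L.Term (Fin n))) e

/-- The set of solutions of `θ` in `A`. -/
def solutions {L : FirstOrder.Language.{u, 0}} (θ : Set (Equation L (Fin 1))) (A : Alg L) : Set A :=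
  {a | ∀ e ∈ θ, Equation.Holds e A fun _ => a}

theorem Compatible.funMap_mem {L : FirstOrder.Language.{u, 0}} {K : AlgClass L}
    {θ : Set (Equation L (Fin 1))} {S : Sublanguage L} (hc : Compatible K θ S) {A : Alg L}
    (hA : K A) {n : ℕ} (φ : S n) (a : Fin n → solutions θ A) :
    FirstOrder.Language.Structure.funMap φ.1 (fun i => (a i : A)) ∈ solutions θ A := by
  intro e he
  have h := hc n φ.1 φ.2 _ (Set.mem_image_of_mem _ he) A hA (fun i => (a i : A)) (by
    intro d hd
    obtain ⟨i, hi⟩ := Set.mem_iUnion.1 hd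
    obtain ⟨d', hd', rfl⟩ := hi
    have := (a i).2 d' hd'
    simpa [Equation.Holds] using this)
  simpa [Equation.Holds] using h

/-- The algebra `θ_S(A)` of type `S`: the solutions of `θ` in `A` with the restrictions of the
operations in `S`. -/
def solutionAlg {L : FirstOrder.Language.{u, 0}} {K : AlgClass L} {θ : Set (Equation L (Fin 1))}
    {S : Sublanguage L} (hc : Compatible K θ S) (A : Alg L) (hA : K A) : Alg S.toLanguage where
  carrier := solutions θ A
  str :=
    { funMap := fun {n} (φ : S n) a =>
        ⟨FirstOrder.Language.Structure.funMap φ.1 fun i => (a i : A), hc.funMap_mem hA φ a⟩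
      RelMap := fun r _ => isEmptyElim r }

theorem Hom.map_solutions {L : FirstOrder.Language.{u, 0}} {θ : Set (Equation L (Fin 1))} {A B : Alg L}
    (f : A →[L] B) {a : A} (ha : a ∈ solutions θ A) : f a ∈ solutions θ B := by
  intro e he
  have h := congrArg f (ha e he)
  rw [← FirstOrder.Language.HomClass.realize_term, ← FirstOrder.Language.HomClass.realize_term] at h
  exact h

/-- The homomorphism `θ_S(f)`: the restriction of `f` to the solutions of `θ`. -/
def solutionMap {L : FirstOrder.Language.{u, 0}} {K : AlgClass L} {θ : Set (Equation L (Fin 1))}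
    {S : Sublanguage L} (hc : Compatible K θ S) {A B : Alg L} (hA : K A) (hB : K B)
    (f : A →[L] B) : solutionAlg hc A hA →[S.toLanguage] solutionAlg hc B hB where
  toFun a := ⟨f a.1, Hom.map_solutions f a.2⟩
  map_fun' {n} (φ : S n) a := Subtype.ext (f.map_fun φ.1 fun i => (a i).1)
  map_rel' r _ := isEmptyElim r

/-- An algebra of type `L'` read as an algebra of type `L` along an arity-preserving map of
operation symbols `ρ : L → L'`. -/
def Alg.reduct {L L' : FirstOrder.Language.{u, 0}} (ρ : L →ᴸ L') (A : Alg L') : Alg L where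
  carrier := A
  str := ρ.reduct A

/-- A homomorphism read along a map of operation symbols. -/
def reductMap {L L' : FirstOrder.Language.{u, 0}} [L.IsAlgebraic] (ρ : L →ᴸ L') {A B : Alg L'}
    (f : A →[L'] B) : A.reduct ρ →[L] B.reduct ρ where
  toFun := f.toFun
  map_fun' φ a := f.map_fun (ρ.onFunction φ) a
  map_rel' r _ := isEmptyElim r

/-- The functor `θ_S : K ⥤ X`, defined whenever `θ` is compatible with `S` in `K` and
`θ_S(A) ∈ X` for all `A ∈ K`. The algebras `θ_S(A)` of type `S` are algebras of the type `L'` of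
`X` via a naming `ρ` of the symbols in `S` by the symbols of `L'`. -/
def solutionFunctor {L L' : FirstOrder.Language.{u, 0}} [L'.IsAlgebraic] (K : AlgClass L) (X : AlgClass L')
    (θ : Set (Equation L (Fin 1))) (S : Sublanguage L) (hc : Compatible K θ S)
    (ρ : L' →ᴸ S.toLanguage)
    (hX : ∀ (A : Alg L) (hA : K A), X ((solutionAlg hc A hA).reduct ρ)) :
    K.FullSubcategory ⥤ X.FullSubcategory where
  obj A := ⟨(solutionAlg hc A.obj A.property).reduct ρ, hX A.obj A.property⟩
  map {A B} f := ObjectProperty.homMk (reductMap ρ (solutionMap hc A.property B.property f.hom))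

/-- The map of symbols `ρ` hits every symbol of the sublanguage `S`, so that `S` consists exactly of
the symbols named by `L'`. -/
def IsNaming {L L' : FirstOrder.Language.{u, 0}} {S : Sublanguage L} (ρ : L' →ᴸ S.toLanguage) : Prop :=
  ∀ n : ℕ, Function.Surjective fun φ : L'.Functions n => ρ.onFunction φ

/-- A right adjoint is trivial if it sends every object to a terminal object. -/
def IsTrivial {C D : Type*} [Category C] [Category D] (G : C ⥤ D) : Prop :=
  ∀ A : C, Nonempty (Limits.IsTerminal (G.obj A))

end UAlg

/-! Representability drives both directions. If `F ⊣ G`, let `P` be the image under `F` of the free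
algebra on one generator in `X`; elements of `G A` correspond naturally to homomorphisms `P → A`.
Take the carrier of `P` as exponent: a point of `A^P` is a homomorphism exactly when it satisfies
the diagram of `P`, which can be written as one-variable equations of the matrix language
(`mem_solutions_diagramEqs`). By a Yoneda argument, an `n`-ary operation of the algebras `G A` is
determined by its value on a universal `n`-tuple of homomorphisms out of `P`; that value is a
`P`-indexed family of terms, hence a symbol of the matrix language (`exists_terms`). Non-triviality
of `G` forces `P` to be nonempty.

For `K` take all models of the generalized quasi-equations valid in `Y^[κ]`, in the variables used
to axiomatize `X`. Axioms of `X`, read on solution sets, become such quasi-equations once `θ(x)` is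
added to the premises for each variable `x`, so they persist in `K`
(`valid_solutionAlg_of_quasiHull`).

For the converse, the left adjoint sends `B` to the algebra of `Y` presented by generators `B × κ`
and relations saying that the resulting map from `B` to `A^κ` is a homomorphism into the solutions
of `θ`. -/

namespace UAlg

open FirstOrder.Language

/-! ### Algebras presented by generators and relations in a generalized quasi-variety. -/

section Presentation

variable {L : FirstOrder.Language.{u, 0}}

/-- Substitution of terms for the variables of an equation. -/
def Equation.subst {V : Type w} {W : Type*} (e : Equation L V) (σ : V → L.Term W) :
    Equation L W :=
  (e.1.subst σ, e.2.subst σ)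

theorem Equation.holds_subst {V : Type w} {W : Type*} (e : Equation L V) (σ : V → L.Term W)
    (A : Alg L) (v : W → A) :
    (e.subst σ).Holds A v ↔ e.Holds A fun x => (σ x).realize v := by
  simp [Equation.Holds, Equation.subst]

theorem Equation.Holds.map {V : Type w} {e : Equation L V} {A B : Alg L} {v : V → A}
    (h : e.Holds A v) (f : A →[L] B) : e.Holds B fun x => f (v x) := by
  have h := congrArg f h
  rw [← HomClass.realize_term, ← HomClass.realize_term] at h
  exact h

theorem Equation.Holds.of_injective {V : Type w} {e : Equation L V} {A B : Alg L} {v : V → A}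
    (f : A →[L] B) (hf : Function.Injective f) (h : e.Holds B fun x => f (v x)) :
    e.Holds A v := by
  apply hf
  rw [← HomClass.realize_term, ← HomClass.realize_term]
  exact h

theorem subst_var {W : Type w} (t : L.Term W) : t.subst Term.var = t := by
  induction t with
  | var => rfl
  | func φ ts ih => simp only [Term.subst, ih]

/-- A map preserving the operations is a homomorphism of algebras of an algebraic type. -/
def algHom [L.IsAlgebraic] {A B : Alg L} (f : A → B)
    (hf : ∀ (n : ℕ) (φ : L.Functions n) (a : Fin n → A),
      f (Structure.funMap φ a) = Structure.funMap φ fun i => f (a i)) : A →[L] B where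
  toFun := f
  map_fun' φ a := hf _ φ a
  map_rel' r _ := isEmptyElim r

/-- A bijective homomorphism is an isomorphism. -/
noncomputable def isoOfBijective [L.IsAlgebraic] {A B : Alg L} (f : A →[L] B)
    (hf : Function.Bijective f) : A ≅ B where
  hom := f
  inv := algHom (Equiv.ofBijective f hf).symm (by
    intro n φ a
    rw [Equiv.symm_apply_eq, Equiv.ofBijective_apply, f.map_fun]
    congr 1
    funext i
    exact ((Equiv.ofBijective f hf).apply_symm_apply (a i)).symm)
  hom_inv_id := FirstOrder.Language.Hom.ext fun x => (Equiv.ofBijective f hf).symm_apply_apply x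
  inv_hom_id := FirstOrder.Language.Hom.ext fun x => (Equiv.ofBijective f hf).apply_symm_apply x

/-- Premises push forward along any homomorphism, and the conclusion pulls back along an injective
one. -/
theorem IsGenQuasiVariety.of_injective {K : AlgClass L} (hK : IsGenQuasiVariety K) {A B : Alg L}
    (f : A →[L] B) (hf : Function.Injective f) (hB : K B) : K A := by
  obtain ⟨V, _, Γ, hΓ⟩ := hK
  rw [hΓ] at hB ⊢
  intro q hq v hv
  exact .of_injective f hf (hB q hq _ fun e he => (hv e he).map f)

variable (K : AlgClass L) {V : Type u} (Φ : Set (Equation L V))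

/-- Two terms are identified when their equality follows from `Φ` relative to `K`. -/
def presentedSetoid : Setoid (L.Term V) where
  r s t := Consequence K Φ (s, t)
  iseqv :=
    { refl := fun _ _ _ _ _ => rfl
      symm := fun h A hA v hv => (h A hA v hv).symm
      trans := fun h h' A hA v hv => (h A hA v hv).trans (h' A hA v hv) }

/-- The algebra presented by the generators `V` and the relations `Φ` relative to `K`. -/
noncomputable def presented [L.IsAlgebraic] : Alg L where
  carrier := Quotient (presentedSetoid K Φ)
  str :=
    { funMap := fun φ a => Quotient.mk _ (Term.func φ fun i => (a i).out)
      RelMap := fun r _ => isEmptyElim r }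

variable [L.IsAlgebraic]

/-- The element of the presented algebra named by a term. -/
def presentedMk (t : L.Term V) : presented K Φ := Quotient.mk (presentedSetoid K Φ) t

variable {K Φ}

theorem presentedMk_surjective : Function.Surjective (presentedMk K Φ) := Quotient.mk_surjective

theorem presentedMk_eq_iff {s t : L.Term V} :
    presentedMk K Φ s = presentedMk K Φ t ↔ Consequence K Φ (s, t) :=
  ⟨fun h => Quotient.exact (s := presentedSetoid K Φ) h, fun h => Quotient.sound h⟩

/-- The chosen representatives in the operations of `presented` do not matter, because relative
consequence is a congruence. -/
theorem funMap_presentedMk {n : ℕ} (φ : L.Functions n) (ts : Fin n → L.Term V) :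
    Structure.funMap φ (fun i => presentedMk K Φ (ts i)) = presentedMk K Φ (Term.func φ ts) := by
  refine presentedMk_eq_iff.2 fun A hA v hv => ?_
  change Structure.funMap φ _ = Structure.funMap φ _
  congr 1
  funext i
  exact presentedMk_eq_iff.1
    (Quotient.out_eq (s := presentedSetoid K Φ) (presentedMk K Φ (ts i))) A hA v hv

theorem realize_presentedMk {W : Type w} (t : L.Term W) (σ : W → L.Term V) :
    t.realize (fun x => presentedMk K Φ (σ x)) = presentedMk K Φ (t.subst σ) := by
  induction t with
  | var => rfl
  | func φ ts ih =>
    simp only [Term.realize, ih, funMap_presentedMk, Term.subst]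

theorem holds_presentedMk {W : Type w} (e : Equation L W) (σ : W → L.Term V) :
    e.Holds (presented K Φ) (fun x => presentedMk K Φ (σ x)) ↔ Consequence K Φ (e.subst σ) := by
  rw [Equation.Holds, realize_presentedMk, realize_presentedMk, presentedMk_eq_iff]
  rfl

/-- Lift an assignment to terms. The premises then become consequences of `Φ`, so an axiom of `K`
applies in every model of `Φ` in `K`, making its conclusion a consequence too. -/
theorem presented_mem (hK : IsGenQuasiVariety K) : K (presented K Φ) := by
  obtain ⟨W, _, Γ, hΓ⟩ := hK
  rw [hΓ]
  intro q hq v hv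
  choose σ hσ using fun x => presentedMk_surjective (v x)
  obtain rfl : (fun x => presentedMk K Φ (σ x)) = v := funext hσ
  rw [holds_presentedMk]
  intro A hA a ha
  rw [Equation.holds_subst]
  refine (hΓ A).1 hA q hq _ fun e he => ?_
  rw [← Equation.holds_subst]
  exact (holds_presentedMk e σ).1 (hv e he) A hA a ha

theorem presented_holds {e : Equation L V} (he : e ∈ Φ) :
    e.Holds (presented K Φ) fun x => presentedMk K Φ (Term.var x) := by
  rw [holds_presentedMk]
  intro A _ v hv
  rw [Equation.holds_subst]
  exact hv e he

/-- The homomorphism from a presented algebra determined by values of the generators that satisfy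
the relations. -/
noncomputable def presentedLift {A : Alg L} (hA : K A) (v : V → A) (hv : ∀ e ∈ Φ, e.Holds A v) :
    presented K Φ →[L] A :=
  algHom (Quotient.lift (fun t : L.Term V => t.realize v) fun _ _ h => h A hA v hv) (by
    intro n φ a
    choose σ hσ using fun x => presentedMk_surjective (a x)
    obtain rfl : (fun x => presentedMk K Φ (σ x)) = a := funext hσ
    rw [funMap_presentedMk]
    rfl)

theorem map_presentedMk {A : Alg L} (f : presented K Φ →[L] A) (t : L.Term V) :
    f (presentedMk K Φ t) = t.realize fun x => f (presentedMk K Φ (Term.var x)) := by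
  have h := HomClass.realize_term f (t := t) (v := fun x => presentedMk K Φ (Term.var x))
  rw [realize_presentedMk] at h
  rw [subst_var] at h
  exact h.symm

theorem presented_hom_ext {A : Alg L} {f g : presented K Φ →[L] A}
    (h : ∀ x, f (presentedMk K Φ (Term.var x)) = g (presentedMk K Φ (Term.var x))) : f = g := by
  refine FirstOrder.Language.Hom.ext fun x => ?_
  obtain ⟨t, rfl⟩ := presentedMk_surjective x
  rw [map_presentedMk, map_presentedMk]
  simp only [h]

end Presentation

/-! ### Coordinatewise reading of matrix-language terms and equations. -/

section Components

variable {L : FirstOrder.Language.{u, 0}} {κ : Type u}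

/-- The `p`-th component of a term of the matrix language, as a term of the original language. -/
def component {V : Type w} : (matrixLanguage L κ).Term V → κ → L.Term (V × κ)
  | .var x, p => .var (x, p)
  | .func t ts, p => Term.subst (L := L) (t p) fun q => component (ts q.1) q.2

theorem realize_component {V : Type w} (A : Alg L) (T : (matrixLanguage L κ).Term V)
    (v : V → matrixPower κ A) (p : κ) :
    (component T p).realize (fun q => v q.1 q.2) = T.realize v p := by
  induction T generalizing p with
  | var => rfl
  | func t ts ih =>
    simp only [component, Term.realize_subst, ih]
    rfl

/-- The equation between the `p`-th components of the two sides. -/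
def Equation.component {V : Type w} (e : Equation (matrixLanguage L κ) V) (p : κ) :
    Equation L (V × κ) :=
  (UAlg.component e.1 p, UAlg.component e.2 p)

theorem Equation.holds_component {V : Type w} (e : Equation (matrixLanguage L κ) V) (A : Alg L)
    (v : V → matrixPower κ A) :
    e.Holds (matrixPower κ A) v ↔ ∀ p, (e.component p).Holds A fun q => v q.1 q.2 := by
  simp only [Equation.Holds, Equation.component, realize_component]
  exact funext_iff

/-- Truth of equations is transported along isomorphisms, so genuine matrix powers suffice. -/
theorem consequence_matrixPowerClass {Y : AlgClass L} {V : Type w}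
    {Φ : Set (Equation (matrixLanguage L κ) V)} {e : Equation (matrixLanguage L κ) V}
    (h : ∀ A, Y A → ∀ v : V → matrixPower κ A,
      (∀ d ∈ Φ, d.Holds (matrixPower κ A) v) → e.Holds (matrixPower κ A) v) :
    Consequence (matrixPowerClass κ Y) Φ e := by
  rintro B ⟨A, hA, ⟨i⟩⟩ v hv
  let f : matrixPower κ A →[matrixLanguage L κ] B := i.hom
  let g : B →[matrixLanguage L κ] matrixPower κ A := i.inv
  have hg : ∀ x, f (g x) = x := fun x => congrArg (fun k : B →[matrixLanguage L κ] B => k x) i.inv_hom_id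
  have := (h A hA (fun x => g (v x)) fun d hd => (hv d hd).map g).map f
  simpa only [hg] using this

end Components

/-! ### The left adjoint of a solution-set functor. -/

section Converse

variable {LX LY : FirstOrder.Language.{u, 0}} {κ : Type u}
  (θ : Set (Equation (matrixLanguage LY κ) (Fin 1)))
  {S : Sublanguage (matrixLanguage LY κ)} (ρ : LX →ᴸ S.toLanguage)

/-- The `p`-th component of the symbol named by `φ`. -/
def namedTerm {n : ℕ} (φ : LX.Functions n) (p : κ) : LY.Term (Fin n × κ) :=
  (show S n from ρ.onFunction φ).1 p

/-- The relations on the generators `B × κ` saying that every `κ`-sequence `(b, ·)` solves `θ` and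
that the operations of `B` are computed by the named symbols. -/
def adjointRelations (B : Alg LX) : Set (Equation LY (B × κ)) :=
  {d | ∃ (b : B), ∃ e ∈ θ, ∃ p : κ, d = (e.component p).subst fun q => Term.var (b, q.2)} ∪
  {d | ∃ (n : ℕ) (φ : LX.Functions n) (b : Fin n → B) (p : κ),
    d = (Term.var (Structure.funMap φ b, p),
      (namedTerm ρ φ p).subst fun q => Term.var (b q.1, q.2))}

variable {θ ρ}

/-- Curried, an assignment of the generators is a map from `B` to `A^κ`; the two families of
relations separate into landing in the solutions and preserving the operations. -/
theorem adjointRelations_hold_iff {B : Alg LX} {A : Alg LY} (v : B × κ → A) :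
    (∀ e ∈ adjointRelations θ ρ B, e.Holds A v) ↔
      (∀ b, (fun p => v (b, p)) ∈ solutions θ (matrixPower κ A)) ∧
      ∀ (n : ℕ) (φ : LX.Functions n) (b : Fin n → B) (p : κ),
        v (Structure.funMap φ b, p) =
          (namedTerm ρ φ p).realize fun q => v (b q.1, q.2) := by
  constructor
  · intro h
    refine ⟨fun b e he => ?_, fun n φ b p => ?_⟩
    · refine (Equation.holds_component _ _ _).2 fun p => ?_
      exact (Equation.holds_subst _ _ _ _).1 (h _ (.inl ⟨b, e, he, p, rfl⟩))
    · have := h _ (.inr ⟨n, φ, b, p, rfl⟩)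
      simpa [Equation.Holds] using this
  · rintro ⟨h₁, h₂⟩ d (⟨b, e, he, p, rfl⟩ | ⟨n, φ, b, p, rfl⟩)
    · rw [Equation.holds_subst]
      exact (Equation.holds_component _ _ _).1 (h₁ b e he) p
    · simpa [Equation.Holds] using h₂ n φ b p

variable [LX.IsAlgebraic] [LY.IsAlgebraic] {Y : AlgClass LY}

/-- Homomorphisms from the algebra presented by `adjointRelations` correspond to homomorphisms into
the algebra of solutions. -/
noncomputable def adjointHomEquiv (hc : Compatible (matrixPowerClass κ Y) θ S) (B : Alg LX)
    (A : Alg LY) (hA : Y A) :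
    (presented Y (adjointRelations θ ρ B) →[LY] A) ≃
      (B →[LX] (solutionAlg hc (matrixPower κ A) (matrixPower_mem κ Y A hA)).reduct ρ) where
  toFun k :=
    have h := (adjointRelations_hold_iff (θ := θ) (ρ := ρ) (B := B)
      (fun x => k (presentedMk _ _ (Term.var x)))).1 fun _ he => (presented_holds he).map k
    algHom (fun b => ⟨fun p => k (presentedMk _ _ (Term.var (b, p))), h.1 b⟩)
      fun n φ b => Subtype.ext (funext fun p => h.2 n φ b p)
  invFun g := presentedLift hA (fun x => (g x.1).1 x.2)
    ((adjointRelations_hold_iff _).2 ⟨fun b => (g b).2, fun _ φ b p =>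
      congrFun (congrArg Subtype.val (g.map_fun φ b)) p⟩)
  left_inv _ := presented_hom_ext fun _ => rfl
  right_inv _ := FirstOrder.Language.Hom.ext fun _ => rfl

theorem isRightAdjoint_solutionFunctor {X : AlgClass LX} (hY : IsGenQuasiVariety Y)
    (hc : Compatible (matrixPowerClass κ Y) θ S)
    (hθ : ∀ (A : Alg (matrixLanguage LY κ)) (hA : matrixPowerClass κ Y A),
      X ((solutionAlg hc A hA).reduct ρ)) :
    (matrixPowerFunctor κ Y (matrixPowerClass κ Y) le_rfl ⋙
      solutionFunctor (matrixPowerClass κ Y) X θ S hc ρ hθ).IsRightAdjoint := by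
  let e : ∀ (B : X.FullSubcategory) (A : Y.FullSubcategory),
      ((⟨presented Y (adjointRelations θ ρ B.obj), presented_mem hY⟩ : Y.FullSubcategory) ⟶ A) ≃
        (B ⟶ (matrixPowerFunctor κ Y (matrixPowerClass κ Y) le_rfl ⋙
          solutionFunctor (matrixPowerClass κ Y) X θ S hc ρ hθ).obj A) := fun B A =>
    { toFun := fun k => ObjectProperty.homMk (adjointHomEquiv hc B.obj A.obj A.property k.hom)
      invFun := fun g => ObjectProperty.homMk
        ((adjointHomEquiv hc B.obj A.obj A.property).symm g.hom)
      left_inv := fun k => InducedCategory.Hom.ext (Equiv.symm_apply_apply _ _)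
      right_inv := fun k => InducedCategory.Hom.ext (Equiv.apply_symm_apply _ _) }
  -- Only naturality in `A` needs checking; it determines the action of the left adjoint on arrows.
  exact (Adjunction.adjunctionOfEquivLeft e fun _ _ _ _ _ => rfl).isRightAdjoint

end Converse

/-! ### Generalized quasi-varieties generated by a class. -/

section Hull

variable {L : FirstOrder.Language.{u, 0}}

/-- The class of all models of the generalized quasi-equations in variables `V` valid in `C`. -/
def quasiHull (V : Type u) (C : AlgClass L) : AlgClass L :=
  fun B => ∀ q : GenQuasiEquation L V, (∀ A, C A → q.Valid A) → q.Valid B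

theorem le_quasiHull (V : Type u) (C : AlgClass L) : C ≤ quasiHull V C :=
  fun A hA _ hq => hq A hA

theorem isGenQuasiVariety_quasiHull (V : Type u) [Infinite V] (C : AlgClass L) :
    IsGenQuasiVariety (quasiHull V C) :=
  ⟨V, inferInstance, {q | ∀ A, C A → q.Valid A}, fun _ => Iff.rfl⟩

/-- When `W` embeds in `V`, renaming variables turns the consequence into a quasi-equation in `V`.
-/
theorem Consequence.quasiHull {V : Type u} {C : AlgClass L} {W : Type w} {Φ : Set (Equation L W)}
    {e : Equation L W} (h : Consequence C Φ e) (i : W → V) (hi : Function.Injective i) :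
    Consequence (quasiHull V C) Φ e := by
  intro B hB v hv
  have key := hB ⟨(fun d => d.subst fun x => Term.var (i x)) '' Φ,
    e.subst fun x => Term.var (i x)⟩ (by
      intro A hA a ha
      rw [Equation.holds_subst]
      refine h A hA _ fun d hd => ?_
      have := ha _ (Set.mem_image_of_mem _ hd)
      rwa [Equation.holds_subst] at this)
  -- Variables outside the range of `i` need some value in `B`, even if `W` is empty; the value of a
  -- side of `e` always provides one.
  have hx : ∀ x, Function.extend i v (fun _ => e.1.realize v) (i x) = v x :=
    fun x => hi.extend_apply _ _ _
  have := key (Function.extend i v fun _ => e.1.realize v) (by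
    rintro _ ⟨d, hd, rfl⟩
    rw [Equation.holds_subst]
    simpa only [Term.realize, hx] using hv d hd)
  rw [Equation.holds_subst] at this
  simpa only [Term.realize, hx] using this

theorem holds_substEqs {θ : Set (Equation L (Fin 1))} {V : Type w} (t : L.Term V) (A : Alg L)
    (v : V → A) : (∀ e ∈ substEqs θ t, e.Holds A v) ↔ t.realize v ∈ solutions θ A := by
  rw [substEqs, Set.forall_mem_image]
  exact forall₂_congr fun e _ => Equation.holds_subst e (fun _ => t) A v

end Hull

/-! ### Homomorphisms out of `P` as solution sets. -/

section Diagram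

variable {L : FirstOrder.Language.{u, 0}}

/-- The one-variable equations over the matrix language with exponent `P` whose solutions in `A^[P]`
are the homomorphisms from `P` to `A`. -/
def diagramEqs (P : Alg L) : Set (Equation (matrixLanguage L P) (Fin 1)) :=
  {d | ∃ e : Equation L P, e.Holds P id ∧
    d = (Term.func (L := matrixLanguage L P) (l := 1)
          (fun _ => e.1.relabel fun p => (0, p)) Term.var,
        Term.func (L := matrixLanguage L P) (l := 1)
          (fun _ => e.2.relabel fun p => (0, p)) Term.var)}

/-- Each symbol used repeats one term in all coordinates. Since `P` is nonempty, equality of the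
resulting constant sequences is the original equation at `a`. -/
theorem mem_solutions_diagramEqs [L.IsAlgebraic] {P : Alg L} [Nonempty P] {A : Alg L}
    (a : matrixPower P.carrier A) :
    a ∈ solutions (diagramEqs P) (matrixPower P.carrier A) ↔ ∃ h : P →[L] A, (h : P → A) = a := by
  have hol : ∀ e : Equation L P,
      Equation.Holds (Term.func (L := matrixLanguage L P) (l := 1)
          (fun _ => e.1.relabel fun p => (0, p)) Term.var,
        Term.func (L := matrixLanguage L P) (l := 1)
          (fun _ => e.2.relabel fun p => (0, p)) Term.var)
        (matrixPower P.carrier A) (fun _ : Fin 1 => a) ↔ e.Holds A a := by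
    intro e
    change (fun _ : P => (e.1.relabel fun p => ((0 : Fin 1), p)).realize fun q => a q.2) =
      (fun _ : P => (e.2.relabel fun p => ((0 : Fin 1), p)).realize fun q => a q.2) ↔ _
    simp only [Term.realize_relabel, funext_iff, forall_const]
    rfl
  constructor
  · intro ha
    refine ⟨algHom a fun n φ p => ?_, rfl⟩
    -- An entry of the operation table of `P`; these alone force `a` to be a homomorphism.
    let e : Equation L P := (Term.var (Structure.funMap φ p), Term.func φ fun i => Term.var (p i))
    have he : e.Holds P id := rfl
    exact (hol e).1 (ha _ ⟨e, he, rfl⟩)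
  · rintro ⟨h, rfl⟩ _ ⟨e, he, rfl⟩
    exact (hol e).2 (he.map h)

end Diagram

/-! ### Transfer of compatibility and of axioms to the hull. -/

section Transfer

variable {L L' : FirstOrder.Language.{u, 0}}

/-- The inclusion of a sublanguage. -/
def Sublanguage.incl (S : Sublanguage L) : S.toLanguage →ᴸ L where
  onFunction := fun {n} (φ : S n) => φ.1
  onRelation := fun {n} (r : S.toLanguage.Relations n) => isEmptyElim r

theorem realize_solutionAlg_reduct {K : AlgClass L} {θ : Set (Equation L (Fin 1))}
    {S : Sublanguage L} (hc : Compatible K θ S) (ρ : L' →ᴸ S.toLanguage) (A : Alg L) (hA : K A)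
    {V : Type w} (t : L'.Term V) (v : V → (solutionAlg hc A hA).reduct ρ) :
    (t.realize v).1 = ((S.incl.comp ρ).onTerm t).realize fun x => (v x).1 := by
  induction t with
  | var => rfl
  | func φ ts ih =>
    simp only [LHom.onTerm, Term.realize, ← ih]
    rfl

/-- The translation of an equation along a map of operation symbols. -/
def Equation.translate (τ : L' →ᴸ L) {V : Type w} (e : Equation L' V) : Equation L V :=
  (τ.onTerm e.1, τ.onTerm e.2)

theorem holds_solutionAlg_reduct {K : AlgClass L} {θ : Set (Equation L (Fin 1))}
    {S : Sublanguage L} (hc : Compatible K θ S) (ρ : L' →ᴸ S.toLanguage) (A : Alg L) (hA : K A)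
    {V : Type w} (e : Equation L' V) (v : V → (solutionAlg hc A hA).reduct ρ) :
    e.Holds _ v ↔ (e.translate (S.incl.comp ρ)).Holds A fun x => (v x).1 := by
  unfold Equation.Holds Equation.translate
  rw [← realize_solutionAlg_reduct hc ρ A hA, ← realize_solutionAlg_reduct hc ρ A hA]
  exact Subtype.ext_iff

/-- Compatibility involves only finitely many variables at a time, and these embed in the infinite
`V`. -/
theorem Compatible.quasiHull {V : Type u} [Infinite V] {C : AlgClass L}
    {θ : Set (Equation L (Fin 1))} {S : Sublanguage L} (hc : Compatible C θ S) :
    Compatible (quasiHull V C) θ S :=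
  fun n φ hφ e he => (hc n φ hφ e he).quasiHull (fun i => Infinite.natEmbedding V i)
    ((Infinite.natEmbedding V).injective.comp Fin.val_injective)

/-- Relativize `q` to solutions by adding `θ(x)` for every `x : V` to the translated premises. No
new variables appear, so the hull over the same `V` preserves it. -/
theorem valid_solutionAlg_of_quasiHull {κ V : Type u} [Infinite V] {Y : AlgClass L}
    {θ : Set (Equation (matrixLanguage L κ) (Fin 1))} {S : Sublanguage (matrixLanguage L κ)}
    (hc : Compatible (matrixPowerClass κ Y) θ S) (ρ : L' →ᴸ S.toLanguage)
    (q : GenQuasiEquation L' V)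
    (hq : ∀ (A : Alg L) (hA : Y A),
      q.Valid ((solutionAlg hc (matrixPower κ A) (matrixPower_mem κ Y A hA)).reduct ρ))
    (B : Alg (matrixLanguage L κ)) (hB : UAlg.quasiHull V (matrixPowerClass κ Y) B) :
    q.Valid ((solutionAlg hc.quasiHull B hB).reduct ρ) := by
  have key : Consequence (matrixPowerClass κ Y)
      ((⋃ x : V, substEqs θ (Term.var x)) ∪ Equation.translate (S.incl.comp ρ) '' q.premises)
      (q.conclusion.translate (S.incl.comp ρ)) := by
    refine consequence_matrixPowerClass fun A hA v hv => ?_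
    have hs : ∀ x, v x ∈ solutions θ (matrixPower κ A) := fun x =>
      (holds_substEqs (Term.var x) _ v).1 fun e he => hv e (.inl (Set.mem_iUnion.2 ⟨x, he⟩))
    refine (holds_solutionAlg_reduct hc ρ _ (matrixPower_mem κ Y A hA) _
      fun x => ⟨v x, hs x⟩).1 (hq A hA _ fun e he => ?_)
    exact (holds_solutionAlg_reduct hc ρ _ (matrixPower_mem κ Y A hA) _ _).2
      (hv _ (.inr (Set.mem_image_of_mem _ he)))
  intro v hv
  refine (holds_solutionAlg_reduct _ ρ B hB _ _).2
    (key.quasiHull id Function.injective_id B hB _ ?_)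
  rintro d (hd | ⟨e, he, rfl⟩)
  · obtain ⟨x, hx⟩ := Set.mem_iUnion.1 hd
    exact (holds_substEqs (Term.var x) B _).2 (v x).2 d hx
  · exact (holds_solutionAlg_reduct _ ρ B hB _ _).1 (hv e he)

end Transfer

/-! ### Corepresentability of right adjoints and the Yoneda argument. -/

section Representation

variable {LX LY : FirstOrder.Language.{u, 0}} {X : AlgClass LX} {Y : AlgClass LY}

/-- An arrow of a class of algebras as a homomorphism. -/
def toHom {L : FirstOrder.Language.{u, 0}} {K : AlgClass L} {A B : K.FullSubcategory}
    (f : A ⟶ B) : A.obj →[L] B.obj := f.hom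

/-- A natural bijection between the homomorphisms from `P` to `A` and the elements of `G A`. -/
structure Corepresentation (G : Y.FullSubcategory ⥤ X.FullSubcategory) (P : Alg LY) where
  equiv : ∀ A : Y.FullSubcategory, (P →[LY] A.obj) ≃ (G.obj A).obj
  natural : ∀ {A B : Y.FullSubcategory} (k : A ⟶ B) (h : P →[LY] A.obj),
    equiv B ((toHom k).comp h) = toHom (G.map k) (equiv A h)

/-- Arrows of a class of algebras are homomorphisms. -/
def arrowEquiv {L : FirstOrder.Language.{u, 0}} {K : AlgClass L} (A B : K.FullSubcategory) :
    (A.obj →[L] B.obj) ≃ (A ⟶ B) where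
  toFun f := ObjectProperty.homMk f
  invFun := toHom

/-- The free algebra on one generator in a generalized quasi-variety. -/
noncomputable def freeOne [LX.IsAlgebraic] (hX : IsGenQuasiVariety X) : X.FullSubcategory :=
  ⟨presented X (V := PUnit) ∅, presented_mem hX⟩

/-- Arrows from the free algebra on one generator are elements. -/
noncomputable def freeOneEquiv [LX.IsAlgebraic] (hX : IsGenQuasiVariety X)
    (B : X.FullSubcategory) : (freeOne hX ⟶ B) ≃ B.obj where
  toFun f := toHom f (presentedMk X ∅ (Term.var PUnit.unit))
  invFun x := ObjectProperty.homMk (presentedLift B.property (fun _ => x) fun _ he => he.elim)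
  left_inv _ := InducedCategory.Hom.ext (presented_hom_ext fun _ => rfl)

/-- A right adjoint is corepresented by the image of the free algebra on one generator under the
left adjoint. -/
noncomputable def Corepresentation.ofAdjunction [LX.IsAlgebraic] (hX : IsGenQuasiVariety X)
    {F : X.FullSubcategory ⥤ Y.FullSubcategory} {G : Y.FullSubcategory ⥤ X.FullSubcategory}
    (adj : F ⊣ G) : Corepresentation G (F.obj (freeOne hX)).obj where
  equiv A := (arrowEquiv _ A).trans ((adj.homEquiv _ A).trans (freeOneEquiv hX _))
  natural {A B} k h := by
    have := adj.homEquiv_naturality_right (arrowEquiv (F.obj (freeOne hX)) A h) k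
    exact congrArg (freeOneEquiv hX _) this

variable {G : Y.FullSubcategory ⥤ X.FullSubcategory} {P : Alg LY}

theorem Corepresentation.equiv_symm_map (c : Corepresentation G P)
    {A B : Y.FullSubcategory} (k : A ⟶ B) (x : (G.obj A).obj) :
    (c.equiv B).symm (toHom (G.map k) x) = (toHom k).comp ((c.equiv A).symm x) := by
  rw [Equiv.symm_apply_eq, c.natural, Equiv.apply_symm_apply]

/-- An empty `P` has exactly one homomorphism to each `A`, so every `G A` would have one element and
be terminal. -/
theorem Corepresentation.nonempty [LX.IsAlgebraic] [LY.IsAlgebraic] (c : Corepresentation G P)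
    (hG : ¬ IsTrivial G) : Nonempty P := by
  by_contra hP
  rw [not_nonempty_iff] at hP
  refine hG fun A => ?_
  have hs : Subsingleton (G.obj A).obj := (c.equiv A).symm.subsingleton_congr.2
    ⟨fun f g => FirstOrder.Language.Hom.ext fun x => hP.elim x⟩
  let a : (G.obj A).obj := c.equiv A (algHom (fun x => hP.elim x) fun n φ x =>
    hP.elim (Structure.funMap φ x))
  exact ⟨Limits.IsTerminal.ofUniqueHom
    (fun B => ObjectProperty.homMk (algHom (fun _ => a) fun n φ x => Subsingleton.elim _ _))
    fun B m => InducedCategory.Hom.ext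
      (FirstOrder.Language.Hom.ext fun x => Subsingleton.elim (α := (G.obj A).obj) _ _)⟩

theorem Corepresentation.exists_terms [LY.IsAlgebraic] (hY : IsGenQuasiVariety Y)
    (c : Corepresentation G P) {n : ℕ} (φ : LX.Functions n) :
    ∃ t : P → LY.Term (Fin n × P), ∀ (A : Y.FullSubcategory) (h : Fin n → (P →[LY] A.obj)) (p : P),
      (c.equiv A).symm (Structure.funMap φ fun i => c.equiv A (h i)) p =
        (t p).realize fun q => h q.1 q.2 := by
  let Ψ : Set (Equation LY (Fin n × P)) :=
    {d | ∃ (i : Fin n) (e : Equation LY P), e.Holds P id ∧ d = e.subst fun p => Term.var (i, p)}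
  -- `C` carries the universal `n`-tuple of homomorphisms out of `P`: the `n`-fold copower when `P`
  -- lies in `Y`.
  let C : Y.FullSubcategory := ⟨presented Y Ψ, presented_mem hY⟩
  let inj : Fin n → (P →[LY] C.obj) := fun i =>
    algHom (fun p => presentedMk Y Ψ (Term.var (i, p))) fun m f a =>
      let e : Equation LY P := (Term.var (Structure.funMap f a), Term.func f fun j => Term.var (a j))
      have he : e.Holds P id := rfl
      (Equation.holds_subst e _ _ _).1 (presented_holds (Φ := Ψ) ⟨i, e, he, rfl⟩)
  -- The operation applied to the universal tuple. Terms naming the values of `k` serve for every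
  -- `A`, by naturality along `g`.
  let k := (c.equiv C).symm (Structure.funMap φ fun i => c.equiv C (inj i))
  choose t ht using fun p => presentedMk_surjective (k p)
  refine ⟨t, fun A h p => ?_⟩
  let g : C ⟶ A := ObjectProperty.homMk (presentedLift A.property (fun q => h q.1 q.2) (by
    rintro _ ⟨i, e, he, rfl⟩
    rw [Equation.holds_subst]
    exact he.map (h i)))
  have hg : ∀ i, (toHom g).comp (inj i) = h i := fun i => FirstOrder.Language.Hom.ext fun p => rfl
  have : (c.equiv A).symm (Structure.funMap φ fun i => c.equiv A (h i)) = (toHom g).comp k := by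
    rw [Equiv.symm_apply_eq, c.natural, Equiv.apply_symm_apply, FirstOrder.Language.Hom.map_fun]
    congr 1
    funext i
    rw [Function.comp_apply, ← c.natural, hg]
  rw [this, FirstOrder.Language.Hom.comp_apply, ← ht p]
  rfl

end Representation

/-! ### Identifying `G` with solution sets of the diagram of `P`. -/

namespace Corepresentation

variable {LX LY : FirstOrder.Language.{u, 0}} [LY.IsAlgebraic] {X : AlgClass LX} {Y : AlgClass LY}
  {G : Y.FullSubcategory ⥤ X.FullSubcategory} {P : Alg LY}
  (c : Corepresentation G P) (hY : IsGenQuasiVariety Y)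

/-- The symbol of the matrix language computing the operation `φ` of the algebras `G A`. -/
noncomputable def symbol {n : ℕ} (φ : LX.Functions n) :
    (matrixLanguage LY P.carrier).Functions n :=
  (c.exists_terms hY φ).choose

theorem funMap_symbol {n : ℕ} (φ : LX.Functions n) (A : Y.FullSubcategory)
    (h : Fin n → (P →[LY] A.obj)) :
    Structure.funMap (M := matrixPower P.carrier A.obj) (c.symbol hY φ) (fun i => ⇑(h i)) =
      ⇑((c.equiv A).symm (Structure.funMap φ fun i => c.equiv A (h i))) :=
  (funext fun p => (c.exists_terms hY φ).choose_spec A h p).symm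

/-- The sublanguage of the symbols that compute the operations of the algebras `G A`. -/
def symbols : Sublanguage (matrixLanguage LY P.carrier) :=
  fun _ => Set.range fun φ => c.symbol hY φ

/-- Solutions are homomorphisms, and on these a symbol computes the homomorphism corresponding to
the value of `φ` in `G A`. -/
theorem compatible [Nonempty P] :
    Compatible (matrixPowerClass P.carrier Y) (diagramEqs P) (c.symbols hY) := by
  rintro n _ ⟨φ, rfl⟩ e he
  refine consequence_matrixPowerClass fun A hA v hv => ?_
  choose h hh using fun i => (mem_solutions_diagramEqs (v i)).1
    ((holds_substEqs (Term.var i) _ v).1 fun d hd => hv d (Set.mem_iUnion.2 ⟨i, hd⟩))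
  obtain rfl : (fun i => ⇑(h i)) = v := funext hh
  refine (holds_substEqs _ _ _).2 ?_ e he
  exact (mem_solutions_diagramEqs _).2
    ⟨(c.equiv ⟨A, hA⟩).symm (Structure.funMap φ fun i => c.equiv ⟨A, hA⟩ (h i)),
      (c.funMap_symbol hY φ ⟨A, hA⟩ h).symm⟩

variable [LX.IsAlgebraic]

/-- The naming of these symbols by the symbols of `LX`. -/
noncomputable def naming : LX →ᴸ (c.symbols hY).toLanguage where
  onFunction := fun {n} φ => (⟨c.symbol hY φ, φ, rfl⟩ : c.symbols hY n)
  onRelation := fun {n} (r : LX.Relations n) => isEmptyElim r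

theorem isNaming_naming : IsNaming (c.naming hY) := by
  rintro n ⟨_, φ, rfl⟩
  exact ⟨φ, rfl⟩

variable [Nonempty P]

/-- The comparison map from `G A` to the algebra of solutions of the diagram of `P`. -/
noncomputable def toSolutions (A : Y.FullSubcategory) :
    (G.obj A).obj →[LX]
      (solutionAlg (c.compatible hY) (matrixPower P.carrier A.obj)
        (matrixPower_mem P.carrier Y A.obj A.property)).reduct (c.naming hY) :=
  algHom (fun x => ⟨⇑((c.equiv A).symm x), (mem_solutions_diagramEqs _).2 ⟨_, rfl⟩⟩) (by
    intro n φ a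
    refine Subtype.ext ?_
    obtain ⟨h, rfl⟩ : ∃ h : Fin n → (P →[LY] A.obj), (fun i => c.equiv A (h i)) = a :=
      ⟨fun i => (c.equiv A).symm (a i), funext fun i => Equiv.apply_symm_apply _ _⟩
    refine (c.funMap_symbol hY φ A h).symm.trans ?_
    simp only [Equiv.symm_apply_apply]
    rfl)

theorem toSolutions_bijective (A : Y.FullSubcategory) :
    Function.Bijective (c.toSolutions hY A) := by
  constructor
  · intro x y hxy
    exact (c.equiv A).symm.injective (DFunLike.coe_injective (congrArg Subtype.val hxy))
  · rintro ⟨a, ha⟩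
    obtain ⟨h, rfl⟩ := (mem_solutions_diagramEqs a).1 ha
    exact ⟨c.equiv A h, Subtype.ext (congrArg DFunLike.coe (Equiv.symm_apply_apply _ h))⟩

/-- The solution algebra is isomorphic to `G A`, and `X` is closed under isomorphism. -/
theorem solutionAlg_mem (hX : IsGenQuasiVariety X) (A : Alg LY) (hA : Y A) :
    X ((solutionAlg (c.compatible hY) (matrixPower P.carrier A)
      (matrixPower_mem P.carrier Y A hA)).reduct (c.naming hY)) := by
  let i := isoOfBijective (c.toSolutions hY ⟨A, hA⟩) (c.toSolutions_bijective hY ⟨A, hA⟩)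
  exact hX.of_injective i.inv
    (Equiv.ofBijective _ (c.toSolutions_bijective hY ⟨A, hA⟩)).symm.injective (G.obj ⟨A, hA⟩).property

/-- A corepresented functor is a composite of a matrix power functor and a functor of solution
sets. -/
noncomputable def isoSolutionFunctor {K : AlgClass (matrixLanguage LY P.carrier)}
    (hK : matrixPowerClass P.carrier Y ≤ K) (hc : Compatible K (diagramEqs P) (c.symbols hY))
    (hθ : ∀ (A : Alg (matrixLanguage LY P.carrier)) (hA : K A),
      X ((solutionAlg hc A hA).reduct (c.naming hY))) :
    G ≅ matrixPowerFunctor P.carrier Y K hK ⋙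
      solutionFunctor K X (diagramEqs P) (c.symbols hY) hc (c.naming hY) hθ :=
  NatIso.ofComponents
    (fun A => X.isoMk (isoOfBijective (c.toSolutions hY A) (c.toSolutions_bijective hY A)))
    (fun k => InducedCategory.Hom.ext (FirstOrder.Language.Hom.ext fun x =>
      Subtype.ext (congrArg DFunLike.coe (c.equiv_symm_map k x))))

end Corepresentation
end UAlg

/-! ### Assembling both directions. -/

theorem theorem5p1 {LX LY : FirstOrder.Language.{u, 0}} [LX.IsAlgebraic] [LY.IsAlgebraic]
    (X : UAlg.AlgClass LX) (Y : UAlg.AlgClass LY)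
    (hX : UAlg.IsGenQuasiVariety X) (hY : UAlg.IsGenQuasiVariety Y) :
    (∀ G : Y.FullSubcategory ⥤ X.FullSubcategory, G.IsRightAdjoint → ¬ UAlg.IsTrivial G →
      ∃ κ : Type u, Nonempty κ ∧
      ∃ K : UAlg.AlgClass (UAlg.matrixLanguage LY κ), UAlg.IsGenQuasiVariety K ∧
      ∃ (hK : UAlg.matrixPowerClass κ Y ≤ K)
        (θ : Set (UAlg.Equation (UAlg.matrixLanguage LY κ) (Fin 1)))
        (S : UAlg.Sublanguage (UAlg.matrixLanguage LY κ))
        (hc : UAlg.Compatible K θ S)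
        (ρ : LX →ᴸ S.toLanguage) (_ : UAlg.IsNaming ρ)
        (hθ : ∀ (A : UAlg.Alg (UAlg.matrixLanguage LY κ)) (hA : K A),
          X ((UAlg.solutionAlg hc A hA).reduct ρ)),
        Nonempty (G ≅ UAlg.matrixPowerFunctor κ Y K hK ⋙
          UAlg.solutionFunctor K X θ S hc ρ hθ)) ∧
    (∀ (κ : Type u), Nonempty κ →
      ∀ (θ : Set (UAlg.Equation (UAlg.matrixLanguage LY κ) (Fin 1)))
        (S : UAlg.Sublanguage (UAlg.matrixLanguage LY κ))
        (hc : UAlg.Compatible (UAlg.matrixPowerClass κ Y) θ S)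
        (ρ : LX →ᴸ S.toLanguage) (_ : UAlg.IsNaming ρ)
        (hθ : ∀ (A : UAlg.Alg (UAlg.matrixLanguage LY κ)) (hA : UAlg.matrixPowerClass κ Y A),
          X ((UAlg.solutionAlg hc A hA).reduct ρ)),
        (UAlg.matrixPowerFunctor κ Y (UAlg.matrixPowerClass κ Y) le_rfl ⋙
          UAlg.solutionFunctor (UAlg.matrixPowerClass κ Y) X θ S hc ρ hθ).IsRightAdjoint) := by

  refine ⟨fun G hG hnt => ?_, fun κ _ θ S hc ρ _ hθ =>
    UAlg.isRightAdjoint_solutionFunctor hY hc hθ⟩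
  let c := UAlg.Corepresentation.ofAdjunction hX (Adjunction.ofIsRightAdjoint G)
  have hP := c.nonempty hnt
  have hX' := hX
  -- Forming the hull over the variables of the axioms of `X` ensures that these axioms transfer to
  -- all of `K`.
  obtain ⟨V, _, Γ, hΓ⟩ := hX'
  refine ⟨_, hP, UAlg.quasiHull V (UAlg.matrixPowerClass _ Y),
    UAlg.isGenQuasiVariety_quasiHull V _, UAlg.le_quasiHull V _, UAlg.diagramEqs _, c.symbols hY,
    (c.compatible hY).quasiHull, c.naming hY, c.isNaming_naming hY, ?_, ?_⟩
  · intro A hA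
    rw [hΓ]
    exact fun q hq => UAlg.valid_solutionAlg_of_quasiHull (c.compatible hY) (c.naming hY) q
      (fun B hB => (hΓ _).1 (c.solutionAlg_mem hY hX B hB) q hq) A hA
  · exact ⟨c.isoSolutionFunctor hY _ _ _⟩
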